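/- Let $D=(V,A)$ be a finite digraph (parallel and antiparallel arcs and loops are allowed; a loop is a directed cycle of length one), and let $c(D)$ be its number of (weakly) connected components. An acyclic coloring of $D$ with $k$ colors is a map from $V$ to a set of $k$ colors for which no directed cycle of $D$ is monochromatic. For $C\subseteq A$ write $A/C$ for the contraction of $D$ by $C$ (with arc set $A\setminus C$), and $rk(A/C)$ for the rank of its incidence matrix. Let $\mathcal C$ be the poset of all contractions $A/C$ where $C$ is a union of finitely many (possibly zero) directed cycles, ordered by inclusion of the contracted sets $C$, so that $A=A/\emptyset$ is the least element; let $\mu$ be its Möbius function, and let $$\psi_{NL}^D(x)=\sum_{Y\in\mathcal C}\mu(A,Y)\,x^{rk(Y)}$$ be the NL-coflow polynomial of $D$. Let $Q$ be the set of all $B\subseteq A$ (including $\emptyset$) for which every component of the subdigraph $D[B]$ is strongly connected, ordered by inclusion, and for $B\in Q$ let $rk_Q(B)$ be the length of a longest chain in $Q$ with greatest element $B$. Then $Q$ is graded with rank function $rk_Q$, that is, $rk_Q(B')=rk_Q(B)+1$ whenever $B'$ covers $B$ in $Q$. There is exactly one polynomial $\chi(D,x)\in\mathbb Z[x]$ such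 that for every integer $k\ge 0$ the value $\chi(D,k)$ is the number of acyclic colorings of $D$ with $k$ colors (the chromatic polynomial of $D$), and $$\chi(D,x)=x^{c(D)}\,\psi_{NL}^D(x)=\sum_{B\in Q}(-1)^{rk_Q(B)}\,x^{rk(A/B)+c(D)}.$$ -/

import Mathlib

open Polynomial

/-- A digraph with vertex set `V` and arc set `A`; parallel arcs, antiparallel arcs and loops
are allowed. -/
structure MultiDigraph (V A : Type*) where
  src : A → V
  tgt : A → V

namespace MultiDigraph

/-- There is an arc from `v` to `w`. -/
def Adj {V A : Type*} (D : MultiDigraph V A) (v w : V) : Prop :=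
  ∃ a : A, D.src a = v ∧ D.tgt a = w

/-- The (weakly) connected components: `Quot` divides `V` by the equivalence relation that the
arcs generate. -/
def Component {V A : Type*} (D : MultiDigraph V A) : Type _ :=
  Quot D.Adj

/-- The number `c(D)` of connected components. -/
noncomputable def numComponents {V A : Type*} (D : MultiDigraph V A) : ℕ :=
  Nat.card D.Component

/-- The subdigraph with all vertices of `D` and with the arcs in `B`. -/
def restrict {V A : Type*} (D : MultiDigraph V A) (B : Finset A) : MultiDigraph V {a // a ∈ B} where
  src a := D.src a.1
  tgt a := D.tgt a.1

/-- The contraction `D / C`: the arcs in `C` are deleted, and each component of the subdigraph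
with arc set `C` becomes a single vertex. -/
def contract {V A : Type*} (D : MultiDigraph V A) (C : Finset A) :
    MultiDigraph (D.restrict C).Component {a // a ∉ C} where
  src a := Quot.mk _ (D.src a.1)
  tgt a := Quot.mk _ (D.tgt a.1)

open Classical in
/-- The incidence matrix; the column of a loop is zero. -/
noncomputable def incMatrix {V A : Type*} (D : MultiDigraph V A) : Matrix V A ℚ :=
  fun v a => (if D.tgt a = v then 1 else 0) - (if D.src a = v then 1 else 0)

/-- The rank of the incidence matrix. -/
noncomputable def rank {V A : Type*} [Finite A] (D : MultiDigraph V A) : ℕ :=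
  letI : Fintype A := Fintype.ofFinite A
  D.incMatrix.rank

/-- `C` is the arc set of a directed cycle: its arcs can be listed cyclically (addition in
`Fin (n + 1)` wraps around) so that each one ends where the next one starts, with no vertex
repeated. A loop is a directed cycle of length one. -/
def IsDirectedCycle {V A : Type*} (D : MultiDigraph V A) (C : Finset A) : Prop :=
  ∃ (n : ℕ) (c : Fin (n + 1) → A),
    Function.Injective (fun i => D.src (c i)) ∧
    (∀ i, D.tgt (c i) = D.src (c (i + 1))) ∧
    ∀ a, a ∈ C ↔ ∃ i, c i = a

/-- Every component is strongly connected. -/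
def IsTotallyCyclic {V A : Type*} (D : MultiDigraph V A) : Prop :=
  ∀ v w : V, (Quot.mk D.Adj v : D.Component) = Quot.mk D.Adj w → Relation.ReflTransGen D.Adj v w

/-- No directed cycle is monochromatic. -/
def IsAcyclicColoring {V A K : Type*} (D : MultiDigraph V A) (f : V → K) : Prop :=
  ∀ C : Finset A, D.IsDirectedCycle C → ¬ ∃ κ : K, ∀ a ∈ C, f (D.src a) = κ ∧ f (D.tgt a) = κ

/-- `p` is the chromatic polynomial of `D`: its value at `k` is the number of acyclic colorings
with `k` colors. -/
def IsChromaticPolynomial {V A : Type*} (D : MultiDigraph V A) (p : ℤ[X]) : Prop :=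
  ∀ k : ℕ, p.eval (k : ℤ) = (Nat.card {f : V → Fin k // D.IsAcyclicColoring f} : ℤ)

/-- `C` is a union of finitely many (possibly zero) directed cycles. -/
def IsUnionOfCycles {V A : Type*} (D : MultiDigraph V A) (C : Finset A) : Prop :=
  ∃ S : Finset (Finset A), (∀ Z ∈ S, D.IsDirectedCycle Z) ∧ ∀ a, a ∈ C ↔ ∃ Z ∈ S, a ∈ Z

/-- The poset of the contractions `A / C`, for `C` a union of directed cycles. The contraction
`A / C` is represented by `C`, and the order is inclusion of the contracted sets `C`, so that
`A = A / ∅` is the least element. -/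
abbrev CyclePoset {V A : Type*} (D : MultiDigraph V A) : Type _ :=
  {C : Finset A // D.IsUnionOfCycles C}

noncomputable instance {V A : Type*} [Finite A] (D : MultiDigraph V A) : Fintype D.CyclePoset :=
  Fintype.ofFinite _

/-- The element `A = A / ∅`. -/
def CyclePoset.uncontracted {V A : Type*} (D : MultiDigraph V A) : D.CyclePoset :=
  ⟨∅, ∅, by simp, by simp⟩

open Classical in
/-- The Möbius function of the poset of contractions. -/
noncomputable def mobius {V A : Type*} [Finite A] (D : MultiDigraph V A)
    (Y Z : D.CyclePoset) : ℤ :=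
  letI : LocallyFiniteOrder D.CyclePoset := Fintype.toLocallyFiniteOrder
  IncidenceAlgebra.mu ℤ Y Z

/-- The NL-coflow polynomial: the sum of `μ(A, Y) x ^ rk(Y)` over the contractions `Y`. -/
noncomputable def nlCoflowPoly {V A : Type*} [Finite A] (D : MultiDigraph V A) : ℤ[X] :=
  ∑ Y : D.CyclePoset,
    C (D.mobius (CyclePoset.uncontracted D) Y) * X ^ (D.contract Y.1).rank

/-- The poset `Q` of the arc sets of totally cyclic subdigraphs, ordered by inclusion. Isolated
vertices are strongly connected, so it makes no difference that `restrict` keeps them. -/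
abbrev Q {V A : Type*} (D : MultiDigraph V A) : Type _ :=
  {B : Finset A // (D.restrict B).IsTotallyCyclic}

noncomputable instance {V A : Type*} [Finite A] (D : MultiDigraph V A) : Fintype D.Q :=
  Fintype.ofFinite _

/-- The rank of `B` in the poset `Q`: the length of a longest chain in `Q` with top `B`. -/
noncomputable def rkQ {V A : Type*} (D : MultiDigraph V A) (B : D.Q) : ℕ :=
  (Order.height B).toNat

end MultiDigraph

/-! Both expansions come from an Euler relation for cones of circulations. A nonnegative flow is a
circulation with nonnegative values. An arc set is the support of one iff it is a union of directed
cycles, and iff all components of its subdigraph are strongly connected (`isUnionOfCycles_iff`,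
`isTotallyCyclic_iff`), so the contraction poset and `Q` are the same poset of supports.

For an arc set `M`, the nonnegative flows supported in `M` form a pointed cone whose faces
correspond to the supports `B ⊆ M`; the face of `B` spans `flowsOn B`. The Euler relation
(`sum_faceTerm`, `sum_isFlowSupport`) says that the sum of `(-1) ^ dim (flowsOn B)` is 1 if the cone
is zero and 0 otherwise. It has two uses. On lower intervals it is the recursion of the Möbius
function, hence `μ(A, A/B) = (-1) ^ dim (flowsOn B)`. For `M` the set of arcs with equally colored
ends, it is the indicator of acyclic colorings; summing over colorings and exchanging sums leaves
`k` to the number of components of `D[B]`, and this number is `rk(A/B) + c(D)`.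

Finally `dim (flowsOn B)` is the rank in `Q`: it increases strictly, and a jump of at least 2 leaves
room for another support (`IsFlowSupport.exists_between`). Equality at all natural numbers makes the
polynomial unique. -/

open Classical in
theorem exists_pos_forall_mul_abs_lt {A : Type*} (s : Finset A) (p q : A → ℚ)
    (hp : ∀ a ∈ s, 0 < p a) : ∃ ε : ℚ, 0 < ε ∧ ∀ a ∈ s, ε * |q a| < p a := by
  induction s using Finset.induction_on with
  | empty => exact ⟨1, one_pos, by simp⟩
  | insert a s _ ih =>
    obtain ⟨ε, hε, h⟩ := ih fun b hb => hp b (Finset.mem_insert_of_mem hb)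
    have hpa := hp a (Finset.mem_insert_self a s)
    have hq : 0 < |q a| + 1 := by positivity
    refine ⟨min ε (p a / (|q a| + 1)), lt_min hε (div_pos hpa hq), fun b hb => ?_⟩
    rcases Finset.mem_insert.1 hb with rfl | hb
    · calc min ε (p b / (|q b| + 1)) * |q b| ≤ p b / (|q b| + 1) * |q b| := by
            gcongr; exact min_le_right _ _
        _ < p b / (|q b| + 1) * (|q b| + 1) := by
            have := div_pos hpa hq
            nlinarith
        _ = p b := by field_simp
    · exact lt_of_le_of_lt (by gcongr; exact min_le_left _ _) (h b hb)

/-! ### The Euler relation for polyhedral cones over ℚ -/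

namespace LinearCone

open scoped Classical

variable {E A : Type*} [AddCommGroup E] [Module ℚ E]

/-- The vectors of `W` on which the functionals `l a`, `a ∈ T`, vanish. -/
def zeros (W : Submodule ℚ E) (l : A → E →ₗ[ℚ] ℚ) (T : Finset A) : Submodule ℚ E where
  carrier := {x | x ∈ W ∧ ∀ a ∈ T, l a x = 0}
  zero_mem' := ⟨W.zero_mem, by simp⟩
  add_mem' hx hy :=
    ⟨W.add_mem hx.1 hy.1, fun a ha => by rw [map_add, hx.2 a ha, hy.2 a ha, add_zero]⟩
  smul_mem' c x hx := ⟨W.smul_mem c hx.1, fun a ha => by rw [map_smul, hx.2 a ha, smul_zero]⟩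

theorem mem_zeros {W : Submodule ℚ E} {l : A → E →ₗ[ℚ] ℚ} {T : Finset A} {x : E} :
    x ∈ zeros W l T ↔ x ∈ W ∧ ∀ a ∈ T, l a x = 0 := Iff.rfl

/-- Some vector of `U` is positive on `B`. -/
def HasPos (U : Submodule ℚ E) (l : A → E →ₗ[ℚ] ℚ) (B : Finset A) : Prop :=
  ∃ x ∈ U, ∀ a ∈ B, 0 < l a x

/-- The contribution of the support `B` to the Euler characteristic of the cone
`{x ∈ W | ∀ a ∈ s, 0 ≤ l a x}`. -/
noncomputable def faceTerm (W : Submodule ℚ E) (l : A → E →ₗ[ℚ] ℚ) (s B : Finset A) : ℤ :=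
  if HasPos (zeros W l (s \ B)) l B then (-1) ^ Module.finrank ℚ (zeros W l (s \ B)) else 0

/-- The cone `{x ∈ W | ∀ a ∈ s, 0 ≤ l a x}` is a linear subspace. -/
def IsLinear (W : Submodule ℚ E) (l : A → E →ₗ[ℚ] ℚ) (s : Finset A) : Prop :=
  ∀ x ∈ W, (∀ a ∈ s, 0 ≤ l a x) → ∀ a ∈ s, l a x = 0

/-- The expected value of the alternating sum over the faces. -/
noncomputable def linearTerm (W : Submodule ℚ E) (l : A → E →ₗ[ℚ] ℚ) (s : Finset A) : ℤ :=
  if IsLinear W l s then (-1) ^ Module.finrank ℚ (zeros W l s) else 0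

/-- On `W`, every functional vanishes where all the others do. -/
def NoColoop (W : Submodule ℚ E) (l : A → E →ₗ[ℚ] ℚ) (s : Finset A) : Prop :=
  ∀ e ∈ s, ∀ x ∈ W, (∀ a ∈ s, a ≠ e → l a x = 0) → l e x = 0

theorem finrank_inf_ker_add_one [FiniteDimensional ℚ E] (U : Submodule ℚ E) (f : E →ₗ[ℚ] ℚ)
    {u : E} (hu : u ∈ U) (hfu : f u ≠ 0) :
    Module.finrank ℚ (U ⊓ LinearMap.ker f : Submodule ℚ E) + 1 = Module.finrank ℚ U := by
  have hsurj : LinearMap.range (f.domRestrict U) = ⊤ := by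
    rw [LinearMap.range_eq_top]
    intro c
    exact ⟨(c / f u) • ⟨u, hu⟩, by simp [hfu]⟩
  have h := (f.domRestrict U).finrank_range_add_finrank_ker
  rw [hsurj, finrank_top, Module.finrank_self] at h
  have hk : (LinearMap.ker (f.domRestrict U)).map U.subtype = U ⊓ LinearMap.ker f := by
    ext x
    simp [LinearMap.mem_ker, and_comm]
  rw [← hk, Submodule.finrank_map_subtype_eq]
  omega

theorem exists_pos_add_smul {U : Submodule ℚ E} {l : A → E →ₗ[ℚ] ℚ}
    {B : Finset A} {x u : E} (hx : x ∈ U) (hB : ∀ a ∈ B, 0 < l a x) (hu : u ∈ U) :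
    ∃ ε : ℚ, 0 < ε ∧ x + ε • u ∈ U ∧ ∀ a ∈ B, 0 < l a (x + ε • u) := by
  obtain ⟨ε, hε, h⟩ := exists_pos_forall_mul_abs_lt B (fun a => l a x) (fun a => l a u) hB
  refine ⟨ε, hε, U.add_mem hx (U.smul_mem _ hu), fun a ha => ?_⟩
  have h1 := h a ha
  have h2 := neg_abs_le (l a u)
  simp only [map_add, map_smul, smul_eq_mul]
  nlinarith

/-- Let `f` be nonzero on `U`. If its kernel meets the open cone, it cuts it into a slice of
dimension one less and two open halves, with signs `-1 + 1 + 1 = 1` relative to the whole. Otherwise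
convexity puts the cone on one side. -/
theorem split_by_functional [FiniteDimensional ℚ E] (U : Submodule ℚ E) (l : A → E →ₗ[ℚ] ℚ)
    (B : Finset A) (f : E →ₗ[ℚ] ℚ) :
    (if HasPos (U ⊓ LinearMap.ker f) l B then
        (-1 : ℤ) ^ Module.finrank ℚ (U ⊓ LinearMap.ker f : Submodule ℚ E) else 0)
      + (if ∃ x ∈ U, (∀ a ∈ B, 0 < l a x) ∧ 0 < f x then (-1) ^ Module.finrank ℚ U else 0)
      + (if ∃ x ∈ U, (∀ a ∈ B, 0 < l a x) ∧ f x < 0 then (-1) ^ Module.finrank ℚ U else 0)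
      = if HasPos U l B then (-1) ^ Module.finrank ℚ U else 0 := by
  by_cases hU : U ≤ LinearMap.ker f
  · have h0 : ∀ x ∈ U, f x = 0 := fun x hx => hU hx
    rw [inf_eq_left.2 hU, if_neg (c := ∃ x ∈ U, (∀ a ∈ B, 0 < l a x) ∧ 0 < f x),
      if_neg (c := ∃ x ∈ U, (∀ a ∈ B, 0 < l a x) ∧ f x < 0), add_zero, add_zero]
    · rintro ⟨x, hx, -, h⟩; exact h.ne (h0 x hx)
    · rintro ⟨x, hx, -, h⟩; exact h.ne' (h0 x hx)
  obtain ⟨u, hu, hfu⟩ : ∃ u ∈ U, 0 < f u := by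
    obtain ⟨u, hu, hfu⟩ := Set.not_subset.1 hU
    rcases lt_or_gt_of_ne (show f u ≠ 0 from hfu) with h | h
    · exact ⟨-u, U.neg_mem hu, by simpa using h⟩
    · exact ⟨u, hu, h⟩
  have hn := finrank_inf_ker_add_one U f hu hfu.ne'
  by_cases h0 : HasPos (U ⊓ LinearMap.ker f) l B
  · obtain ⟨x, ⟨hx, hfx⟩, hxB⟩ := h0
    have hfx : f x = 0 := hfx
    have hp : ∃ x ∈ U, (∀ a ∈ B, 0 < l a x) ∧ 0 < f x := by
      obtain ⟨ε, hε, h1, h2⟩ := exists_pos_add_smul hx hxB hu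
      exact ⟨_, h1, h2, by simp [hfx, hε, hfu]⟩
    have hm : ∃ x ∈ U, (∀ a ∈ B, 0 < l a x) ∧ f x < 0 := by
      obtain ⟨ε, hε, h1, h2⟩ := exists_pos_add_smul hx hxB (U.neg_mem hu)
      exact ⟨_, h1, h2, by simp [hfx, hε, hfu]⟩
    rw [if_pos ⟨x, ⟨hx, hfx⟩, hxB⟩, if_pos hp, if_pos hm, if_pos ⟨x, hx, hxB⟩, ← hn, pow_succ]
    ring
  · rw [if_neg h0]
    by_cases hp : ∃ x ∈ U, (∀ a ∈ B, 0 < l a x) ∧ 0 < f x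
    · have hm : ¬ ∃ x ∈ U, (∀ a ∈ B, 0 < l a x) ∧ f x < 0 := by
        rintro ⟨y, hy, hyB, hfy⟩
        obtain ⟨x, hx, hxB, hfx⟩ := hp
        refine h0 ⟨(-f y) • x + f x • y, ⟨U.add_mem (U.smul_mem _ hx) (U.smul_mem _ hy), ?_⟩,
          fun a ha => ?_⟩
        · simp [mul_comm]
        · have h1 := mul_pos (neg_pos.2 hfy) (hxB a ha)
          have h2 := mul_pos hfx (hyB a ha)
          simp only [map_add, map_smul, smul_eq_mul]
          linarith
      have hf : HasPos U l B := let ⟨x, hx, hxB, _⟩ := hp; ⟨x, hx, hxB⟩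
      rw [if_pos hp, if_neg hm, if_pos hf]; ring
    · by_cases hm : ∃ x ∈ U, (∀ a ∈ B, 0 < l a x) ∧ f x < 0
      · have hf : HasPos U l B := let ⟨x, hx, hxB, _⟩ := hm; ⟨x, hx, hxB⟩
        rw [if_neg hp, if_pos hm, if_pos hf]; ring
      · have hf : ¬ HasPos U l B := by
          rintro ⟨x, hx, hxB⟩
          rcases lt_trichotomy (f x) 0 with h | h | h
          · exact hm ⟨x, hx, hxB, h⟩
          · exact h0 ⟨x, ⟨hx, h⟩, hxB⟩
          · exact hp ⟨x, hx, hxB, h⟩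
        rw [if_neg hp, if_neg hm, if_neg hf]; ring

/-- Reversing the functional with index `e`. -/
noncomputable def flip (l : A → E →ₗ[ℚ] ℚ) (e : A) : A → E →ₗ[ℚ] ℚ :=
  Function.update l e (-l e)

theorem flip_self (l : A → E →ₗ[ℚ] ℚ) (e : A) : flip l e e = -l e := by
  simp [flip]

theorem flip_of_ne (l : A → E →ₗ[ℚ] ℚ) {e a : A} (h : a ≠ e) :
    flip l e a = l a := by
  simp [flip, h]

theorem zeros_flip (W : Submodule ℚ E) (l : A → E →ₗ[ℚ] ℚ) (e : A)
    (T : Finset A) : zeros W (flip l e) T = zeros W l T := by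
  ext x
  simp only [mem_zeros]
  refine and_congr_right fun _ => forall₂_congr fun a _ => ?_
  by_cases h : a = e
  · subst h; simp [flip_self]
  · rw [flip_of_ne l h]

theorem zeros_insert (W : Submodule ℚ E) (l : A → E →ₗ[ℚ] ℚ) (e : A)
    (T : Finset A) : zeros W l (insert e T) = zeros W l T ⊓ LinearMap.ker (l e) := by
  ext x
  simp only [mem_zeros, Submodule.mem_inf, Finset.forall_mem_insert, LinearMap.mem_ker]
  tauto

theorem zeros_inf_ker (W : Submodule ℚ E) (l : A → E →ₗ[ℚ] ℚ) (f : E →ₗ[ℚ] ℚ)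
    (T : Finset A) : zeros (W ⊓ LinearMap.ker f) l T = zeros W l T ⊓ LinearMap.ker f := by
  ext x
  simp only [mem_zeros, Submodule.mem_inf, LinearMap.mem_ker]
  tauto

theorem hasPos_congr {U : Submodule ℚ E} {l l' : A → E →ₗ[ℚ] ℚ} {B : Finset A}
    (h : ∀ a ∈ B, l a = l' a) : HasPos U l B ↔ HasPos U l' B := by
  unfold HasPos
  refine exists_congr fun x => and_congr_right fun _ => forall₂_congr fun a ha => ?_
  rw [h a ha]

theorem hasPos_insert {U : Submodule ℚ E} {l : A → E →ₗ[ℚ] ℚ} {B : Finset A}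
    {e : A} : HasPos U l (insert e B) ↔ ∃ x ∈ U, (∀ a ∈ B, 0 < l a x) ∧ 0 < l e x := by
  unfold HasPos
  simp only [Finset.forall_mem_insert, and_comm]
section
variable (W : Submodule ℚ E) (l : A → E →ₗ[ℚ] ℚ) {e : A} {s B : Finset A}

theorem faceTerm_insert_of_notMem (he : e ∉ B) :
    faceTerm W l (insert e s) B = faceTerm (W ⊓ LinearMap.ker (l e)) l s B := by
  unfold faceTerm
  rw [Finset.insert_sdiff_of_notMem _ he, zeros_insert, zeros_inf_ker]

theorem faceTerm_insert_insert (hs : e ∉ s) :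
    faceTerm W l (insert e s) (insert e B) =
      if ∃ x ∈ zeros W l (s \ B), (∀ a ∈ B, 0 < l a x) ∧ 0 < l e x then
        (-1) ^ Module.finrank ℚ (zeros W l (s \ B)) else 0 := by
  have h : insert e s \ insert e B = s \ B := by
    ext a
    simp only [Finset.mem_sdiff, Finset.mem_insert]
    constructor
    · tauto
    · rintro ⟨h1, h2⟩
      have : a ≠ e := by rintro rfl; exact hs h1
      tauto
  unfold faceTerm
  rw [h]
  simp only [hasPos_insert]

theorem faceTerm_flip_of_notMem (he : e ∉ B) :
    faceTerm W (flip l e) s B = faceTerm W l s B := by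
  have : HasPos (zeros W l (s \ B)) (flip l e) B ↔ HasPos (zeros W l (s \ B)) l B :=
    hasPos_congr fun a ha => flip_of_ne l (by rintro rfl; exact he ha)
  unfold faceTerm
  rw [zeros_flip]
  simp only [this]

theorem faceTerm_reversal [FiniteDimensional ℚ E] (hs : e ∉ s) (hB : B ⊆ s) :
    (faceTerm W l (insert e s) B + faceTerm W l (insert e s) (insert e B))
      + (faceTerm W (flip l e) (insert e s) B + faceTerm W (flip l e) (insert e s) (insert e B))
      = faceTerm (W ⊓ LinearMap.ker (l e)) l s B + faceTerm W l s B := by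
  have he : e ∉ B := fun h => hs (hB h)
  rw [faceTerm_flip_of_notMem W l he, faceTerm_insert_of_notMem W l he,
    faceTerm_insert_insert W l hs, faceTerm_insert_insert W (flip l e) hs]
  have key := split_by_functional (zeros W l (s \ B)) l B (l e)
  rw [← zeros_inf_ker] at key
  have h2 : (∃ x ∈ zeros W l (s \ B), (∀ a ∈ B, 0 < flip l e a x) ∧ 0 < flip l e e x) ↔
      ∃ x ∈ zeros W l (s \ B), (∀ a ∈ B, 0 < l a x) ∧ l e x < 0 := by
    refine exists_congr fun x => and_congr_right fun _ => and_congr ?_ (by simp [flip_self])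
    refine forall₂_congr fun a ha => ?_
    rw [flip_of_ne l (by rintro rfl; exact he ha)]
  rw [zeros_flip]
  simp only [h2]
  unfold faceTerm
  linarith

/-- A deletion–contraction identity: the hyperplane of `e` cuts the cone of `s` into the cones of
`l` and `flip l e`. The faces in the hyperplane are counted twice on the left, which accounts for
the first sum on the right. -/
theorem sum_faceTerm_reversal [FiniteDimensional ℚ E] (hs : e ∉ s) :
    (∑ B ∈ (insert e s).powerset, faceTerm W l (insert e s) B)
      + ∑ B ∈ (insert e s).powerset, faceTerm W (flip l e) (insert e s) B
      = (∑ B ∈ s.powerset, faceTerm (W ⊓ LinearMap.ker (l e)) l s B)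
        + ∑ B ∈ s.powerset, faceTerm W l s B := by
  simp only [Finset.sum_powerset_insert hs, ← Finset.sum_add_distrib]
  exact Finset.sum_congr rfl fun B hB => faceTerm_reversal W l hs (Finset.mem_powerset.1 hB)

/-- By `hco` all four lineality spaces coincide, so only indicators matter. The whole cone is linear
iff both halves are, the slice iff at least one half is, and `[p] + [q] = [p ∨ q] + [p ∧ q]`. -/
theorem linearTerm_reversal (hs : e ∉ s)
    (hco : ∀ x ∈ W, (∀ a ∈ s, l a x = 0) → l e x = 0) :
    linearTerm W l (insert e s) + linearTerm W (flip l e) (insert e s)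
      = linearTerm (W ⊓ LinearMap.ker (l e)) l s + linearTerm W l s := by
  have hz : zeros W l s ⊓ LinearMap.ker (l e) = zeros W l s :=
    inf_eq_left.2 fun x hx => hco x hx.1 hx.2
  have hfl : ∀ a ∈ s, flip l e a = l a := fun a ha =>
    flip_of_ne l (by rintro rfl; exact hs ha)
  have h1 : IsLinear W l (insert e s) ↔
      ∀ x ∈ W, 0 ≤ l e x → (∀ a ∈ s, 0 ≤ l a x) → ∀ a ∈ s, l a x = 0 := by
    unfold IsLinear
    simp only [Finset.forall_mem_insert]
    refine ⟨fun h x hx h0 hs => (h x hx ⟨h0, hs⟩).2, fun h x hx hh => ?_⟩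
    have := h x hx hh.1 hh.2
    exact ⟨hco x hx this, this⟩
  have h2 : IsLinear W (flip l e) (insert e s) ↔
      ∀ x ∈ W, l e x ≤ 0 → (∀ a ∈ s, 0 ≤ l a x) → ∀ a ∈ s, l a x = 0 := by
    have e1 : ∀ x, (∀ a ∈ s, 0 ≤ flip l e a x) ↔ ∀ a ∈ s, 0 ≤ l a x := fun x =>
      forall₂_congr fun a ha => by rw [hfl a ha]
    have e2 : ∀ x, (∀ a ∈ s, flip l e a x = 0) ↔ ∀ a ∈ s, l a x = 0 := fun x =>
      forall₂_congr fun a ha => by rw [hfl a ha]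
    unfold IsLinear
    simp only [Finset.forall_mem_insert, e1, e2, flip_self, LinearMap.neg_apply,
      Left.nonneg_neg_iff, neg_eq_zero]
    refine ⟨fun h x hx h0 hs => (h x hx ⟨h0, hs⟩).2, fun h x hx hh => ?_⟩
    have := h x hx hh.1 hh.2
    exact ⟨hco x hx this, this⟩
  have h3 : IsLinear (W ⊓ LinearMap.ker (l e)) l s ↔
      ∀ x ∈ W, l e x = 0 → (∀ a ∈ s, 0 ≤ l a x) → ∀ a ∈ s, l a x = 0 := by
    unfold IsLinear
    simp only [Submodule.mem_inf, LinearMap.mem_ker, and_imp]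
  unfold linearTerm
  rw [zeros_flip, zeros_insert, zeros_inf_ker, hz]
  by_cases c1 : IsLinear W l (insert e s) <;> by_cases c2 : IsLinear W (flip l e) (insert e s)
  · have c4 : IsLinear W l s := fun x hx hh => by
      rcases le_total 0 (l e x) with h | h
      · exact h1.1 c1 x hx h hh
      · exact h2.1 c2 x hx h hh
    have c3 : IsLinear (W ⊓ LinearMap.ker (l e)) l s := fun x hx hh => c4 x hx.1 hh
    simp [c1, c2, c3, c4]
  · have c4 : ¬ IsLinear W l s := fun c => c2 (h2.2 fun x hx _ hh => c x hx hh)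
    have c3 : IsLinear (W ⊓ LinearMap.ker (l e)) l s :=
      h3.2 fun x hx h0 hh => h1.1 c1 x hx h0.ge hh
    simp [c1, c2, c3, c4]
  · have c4 : ¬ IsLinear W l s := fun c => c1 (h1.2 fun x hx _ hh => c x hx hh)
    have c3 : IsLinear (W ⊓ LinearMap.ker (l e)) l s :=
      h3.2 fun x hx h0 hh => h2.1 c2 x hx h0.le hh
    simp [c1, c2, c3, c4]
  · have c4 : ¬ IsLinear W l s := fun c => c2 (h2.2 fun x hx _ hh => c x hx hh)
    have c3 : ¬ IsLinear (W ⊓ LinearMap.ker (l e)) l s := by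
      intro c3
      rw [h3] at c3
      rw [h1] at c1
      rw [h2] at c2
      push Not at c1 c2
      obtain ⟨x, hx, hx0, hxs, a, ha, hxa⟩ := c1
      obtain ⟨y, hy, hy0, hys, b, hb, hyb⟩ := c2
      rcases hy0.lt_or_eq with hy1 | hy1
      -- The point where the segment from `x` to `y` crosses the hyperplane, up to scaling; it is
      -- still positive at `a`.
      · have := c3 ((-l e y) • x + l e x • y) (W.add_mem (W.smul_mem _ hx) (W.smul_mem _ hy))
          (by simp [mul_comm]) (fun b hb => by
            have k1 := mul_nonneg (neg_nonneg.2 hy0) (hxs b hb)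
            have k2 := mul_nonneg hx0 (hys b hb)
            simp only [map_add, map_smul, smul_eq_mul]
            linarith) a ha
        simp only [map_add, map_smul, smul_eq_mul] at this
        have k1 := mul_pos (neg_pos.2 hy1) (lt_of_le_of_ne (hxs a ha) (Ne.symm hxa))
        have k2 := mul_nonneg hx0 (hys a ha)
        linarith
      · exact hyb (c3 y hy hy1 hys b hb)
    simp [c1, c2, c3, c4]

end

/-- Without coloops, `l e` restricted to `W` lies in the span of the other functionals, by duality.
-/
theorem NoColoop.exists_relation_ne_zero {W : Submodule ℚ E} {l : A → E →ₗ[ℚ] ℚ} {s : Finset A}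
    (h : NoColoop W l s) {e : A} (he : e ∈ s) :
    ∃ c : A → ℚ, c e ≠ 0 ∧ ∀ x ∈ W, ∑ a ∈ s, c a * l a x = 0 := by
  have hm : (l e).domRestrict W ∈
      Submodule.span ℚ (Set.range fun a : {a // a ∈ s.erase e} => (l a.1).domRestrict W) := by
    refine mem_span_of_iInf_ker_le_ker fun x hx => ?_
    refine h e he x.1 x.2 fun a ha hae => ?_
    exact (Submodule.mem_iInf _).1 hx ⟨a, Finset.mem_erase.2 ⟨hae, ha⟩⟩
  obtain ⟨c, hc⟩ := (Submodule.mem_span_range_iff_exists_fun ℚ).1 hm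
  refine ⟨fun a => if ha : a ∈ s.erase e then c ⟨a, ha⟩ else -1, by simp, fun x hx => ?_⟩
  have hcx := LinearMap.congr_fun hc ⟨x, hx⟩
  simp only [LinearMap.sum_apply, LinearMap.smul_apply, LinearMap.domRestrict_apply,
    smul_eq_mul] at hcx
  rw [← Finset.add_sum_erase s _ he, ← Finset.sum_attach, ← Finset.univ_eq_attach]
  have : ∀ a : {a // a ∈ s.erase e}, (if ha : a.1 ∈ s.erase e then c ⟨a.1, ha⟩ else -1) = c a :=
    fun a => by rw [dif_pos a.2]
  simp only [this, hcx]
  simp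

theorem NoColoop.exists_relation {W : Submodule ℚ E} {l : A → E →ₗ[ℚ] ℚ} {s : Finset A}
    (h : NoColoop W l s) :
    ∃ c : A → ℚ, (∀ a ∈ s, c a ≠ 0) ∧ ∀ x ∈ W, ∑ a ∈ s, c a * l a x = 0 := by
  suffices ∀ t ⊆ s, ∃ c : A → ℚ, (∀ a ∈ t, c a ≠ 0) ∧ ∀ x ∈ W, ∑ a ∈ s, c a * l a x = 0 from
    this s subset_rfl
  intro t
  induction t using Finset.induction_on with
  | empty => exact fun _ => ⟨0, by simp, by simp⟩
  | insert e t _ ih =>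
    intro hts
    obtain ⟨c, hc, hcW⟩ := ih fun a ha => hts (Finset.mem_insert_of_mem ha)
    obtain ⟨d, hd, hdW⟩ := h.exists_relation_ne_zero (hts (Finset.mem_insert_self e t))
    by_cases hce : c e = 0
    -- A multiple of `d` too small to cancel any nonzero coefficient of `c` on `t`.
    · obtain ⟨ε, hε, hlt⟩ := exists_pos_forall_mul_abs_lt t (fun a => |c a|) d
        fun a ha => abs_pos.2 (hc a ha)
      refine ⟨fun a => c a + ε * d a, ?_, fun x hx => ?_⟩
      · intro a ha
        rcases Finset.mem_insert.1 ha with rfl | ha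
        · simp [hce, hd, hε.ne']
        · intro h0
          have h1 := hlt a ha
          have h2 : c a = -(ε * d a) := by linarith
          rw [h2, abs_neg, abs_mul, abs_of_pos hε] at h1
          exact lt_irrefl _ h1
      · have : ∀ a, (c a + ε * d a) * l a x = c a * l a x + ε * (d a * l a x) := fun a => by ring
        simp only [this, Finset.sum_add_distrib, ← Finset.mul_sum, hcW x hx, hdW x hx]
        simp
    · refine ⟨c, fun a ha => ?_, hcW⟩
      rcases Finset.mem_insert.1 ha with rfl | ha
      · exact hce
      · exact hc a ha

/-- Reversing all functionals with indices in `t`. -/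
noncomputable def flipSet (l : A → E →ₗ[ℚ] ℚ) (t : Finset A) :
    A → E →ₗ[ℚ] ℚ :=
  fun a => if a ∈ t then -l a else l a

theorem flipSet_insert (l : A → E →ₗ[ℚ] ℚ) {e : A} {t : Finset A} (he : e ∉ t) :
    flipSet l (insert e t) = flip (flipSet l t) e := by
  funext a
  by_cases h : a = e
  · subst h; simp [flip_self, flipSet, he]
  · rw [flip_of_ne _ h]; simp [flipSet, h]

theorem NoColoop.flipSet {W : Submodule ℚ E} {l : A → E →ₗ[ℚ] ℚ} {s : Finset A}
    (h : NoColoop W l s) (t : Finset A) : NoColoop W (flipSet l t) s := by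
  have hz : ∀ a x, LinearCone.flipSet l t a x = 0 ↔ l a x = 0 := fun a x => by
    unfold LinearCone.flipSet; split_ifs <;> simp
  intro e he x hx hh
  simp only [hz] at hh ⊢
  exact h e he x hx hh

/-- Reversing the functionals with negative coefficient in a nowhere zero relation makes all its
coefficients positive; nonnegative values satisfying it must then vanish. -/
theorem NoColoop.exists_isLinear_flipSet {W : Submodule ℚ E}
    {l : A → E →ₗ[ℚ] ℚ} {s : Finset A} (h : NoColoop W l s) :
    ∃ t ⊆ s, IsLinear W (LinearCone.flipSet l t) s := by
  obtain ⟨c, hc, hcW⟩ := h.exists_relation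
  refine ⟨s.filter fun a => c a < 0, Finset.filter_subset _ _, fun x hx hh => ?_⟩
  have key : ∀ a ∈ s, c a * l a x =
      |c a| * LinearCone.flipSet l (s.filter fun a => c a < 0) a x := by
    intro a ha
    unfold LinearCone.flipSet
    by_cases hca : c a < 0
    · simp [ha, hca, abs_of_neg hca]
    · simp [hca, abs_of_nonneg (not_lt.1 hca)]
  have hsum := hcW x hx
  rw [Finset.sum_congr rfl key,
    Finset.sum_eq_zero_iff_of_nonneg fun a ha => mul_nonneg (abs_nonneg _) (hh a ha)] at hsum
  intro a ha
  exact (mul_eq_zero.1 (hsum a ha)).resolve_left (abs_ne_zero.2 (hc a ha))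

theorem sum_faceTerm_of_isLinear {W : Submodule ℚ E} {l : A → E →ₗ[ℚ] ℚ} {s : Finset A}
    (h : IsLinear W l s) : ∑ B ∈ s.powerset, faceTerm W l s B = linearTerm W l s := by
  rw [Finset.sum_eq_single ∅]
  · have : HasPos (zeros W l (s \ ∅)) l ∅ := ⟨0, Submodule.zero_mem _, by simp⟩
    rw [Finset.sdiff_empty] at this
    unfold faceTerm linearTerm
    rw [Finset.sdiff_empty, if_pos this, if_pos h]
  · intro B hB hne
    refine if_neg ?_
    rintro ⟨x, hx, hpos⟩
    obtain ⟨a, ha⟩ := Finset.nonempty_iff_ne_empty.2 hne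
    have hBs := Finset.mem_powerset.1 hB
    refine (hpos a ha).ne' (h x hx.1 (fun b hb => ?_) a (hBs ha))
    by_cases hbB : b ∈ B
    · exact (hpos b hbB).le
    · exact (hx.2 b (Finset.mem_sdiff.2 ⟨hb, hbB⟩)).ge
  · intro h; exact absurd (Finset.empty_mem_powerset s) h

/-- Moving along `u` changes `l e` freely and leaves the functionals in `s` fixed. So `B` and
`insert e B` give faces together or not at all, in dimensions differing by one, and they cancel. -/
theorem sum_faceTerm_of_coloop [FiniteDimensional ℚ E] {W : Submodule ℚ E}
    {l : A → E →ₗ[ℚ] ℚ} {s : Finset A} {e : A} (hs : e ∉ s) {u : E} (hu : u ∈ W)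
    (hus : ∀ a ∈ s, l a u = 0) (hue : l e u ≠ 0) :
    ∑ B ∈ (insert e s).powerset, faceTerm W l (insert e s) B = 0 := by
  rw [Finset.sum_powerset_insert hs, ← Finset.sum_add_distrib]
  refine Finset.sum_eq_zero fun B hB => ?_
  have hBs := Finset.mem_powerset.1 hB
  have he : e ∉ B := fun h => hs (hBs h)
  rw [faceTerm_insert_of_notMem W l he, faceTerm_insert_insert W l hs]
  unfold faceTerm
  rw [zeros_inf_ker]
  have huz : u ∈ zeros W l (s \ B) := ⟨hu, fun a ha => hus a (Finset.mem_sdiff.1 ha).1⟩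
  have hn := finrank_inf_ker_add_one _ (l e) huz hue
  have hshift : ∀ x ∈ zeros W l (s \ B), (∀ a ∈ B, 0 < l a x) → ∀ r : ℚ,
      ∃ y ∈ zeros W l (s \ B), (∀ a ∈ B, 0 < l a y) ∧ l e y = r := by
    intro x hx hxB r
    refine ⟨x + ((r - l e x) / l e u) • u, Submodule.add_mem _ hx (Submodule.smul_mem _ _ huz),
      fun a ha => ?_, ?_⟩
    · simpa [hus a (hBs ha)] using hxB a ha
    · simp [hue]
  have hiff : HasPos (zeros W l (s \ B) ⊓ LinearMap.ker (l e)) l B ↔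
      ∃ x ∈ zeros W l (s \ B), (∀ a ∈ B, 0 < l a x) ∧ 0 < l e x := by
    constructor
    · rintro ⟨x, hx, hxB⟩
      obtain ⟨y, hy, hyB, h⟩ := hshift x hx.1 hxB 1
      exact ⟨y, hy, hyB, by simp [h]⟩
    · rintro ⟨x, hx, hxB, -⟩
      obtain ⟨y, hy, hyB, h⟩ := hshift x hx hxB 0
      exact ⟨y, ⟨hy, h⟩, hyB⟩
  simp only [hiff, ← hn]
  split_ifs
  · rw [pow_succ]; ring
  · simp

/-- The Euler relation for polyhedral cones. -/
theorem sum_faceTerm [FiniteDimensional ℚ E] (W : Submodule ℚ E) (l : A → E →ₗ[ℚ] ℚ)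
    (s : Finset A) : ∑ B ∈ s.powerset, faceTerm W l s B = linearTerm W l s := by
  induction hn : s.card using Nat.strong_induction_on generalizing s W l with
  | _ n ih =>
  subst hn
  by_cases hco : NoColoop W l s
  -- Both sides obey the same reversal identity and agree on `s.erase e` by induction, so the
  -- relation passes from `flip l e` to `l`. Reversals leading to a linear cone can thus be undone
  -- one by one.
  · have step : ∀ (l : A → E →ₗ[ℚ] ℚ) (e : A), e ∈ s → NoColoop W l s →
        ∑ B ∈ s.powerset, faceTerm W (flip l e) s B = linearTerm W (flip l e) s →
        ∑ B ∈ s.powerset, faceTerm W l s B = linearTerm W l s := by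
      intro l e he hl h
      have hcard : (s.erase e).card < s.card := Finset.card_erase_lt_of_mem he
      have hne := Finset.notMem_erase e s
      have h1 := sum_faceTerm_reversal W l hne
      have h2 := linearTerm_reversal W l hne fun x hx hh =>
        hl e he x hx fun a ha hae => hh a (Finset.mem_erase.2 ⟨hae, ha⟩)
      rw [Finset.insert_erase he] at h1 h2
      rw [ih _ hcard _ _ _ rfl, ih _ hcard _ _ _ rfl, h, ← h2] at h1
      exact add_right_cancel h1
    obtain ⟨t, hts, ht⟩ := hco.exists_isLinear_flipSet
    have hlin := sum_faceTerm_of_isLinear ht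
    clear ht
    induction t using Finset.induction_on with
    | empty =>
      have : flipSet l ∅ = l := funext fun a => by simp [flipSet]
      rwa [this] at hlin
    | insert e t he iht =>
      rw [flipSet_insert l he] at hlin
      exact iht (fun a ha => hts (Finset.mem_insert_of_mem ha))
        (step _ e (hts (Finset.mem_insert_self e t)) (hco.flipSet t) hlin)
  · unfold NoColoop at hco
    push Not at hco
    obtain ⟨e, he, u, hu, hus, hue⟩ := hco
    have h := sum_faceTerm_of_coloop (Finset.notMem_erase e s) hu
      (fun a ha => hus a (Finset.mem_of_mem_erase ha) (Finset.ne_of_mem_erase ha)) hue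
    rw [Finset.insert_erase he] at h
    rw [h, linearTerm, if_neg]
    intro hl
    rcases lt_or_gt_of_ne hue with h0 | h0
    · have := hl (-u) (W.neg_mem hu) (fun a ha => by
        by_cases hae : a = e
        · subst hae; simpa using h0.le
        · simp [hus a ha hae]) e he
      simp [hue] at this
    · exact hue (hl u hu (fun a ha => by
        by_cases hae : a = e
        · subst hae; exact h0.le
        · simp [hus a ha hae]) e he)

end LinearCone

/-! ### Supports of nonnegative flows, directed cycles and strong connectivity -/

namespace MultiDigraph

section
open LinearCone
open scoped Classical

variable {V A : Type*} [Fintype A] (D : MultiDigraph V A)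

/-- The space of flows (circulations), in weak form. -/
def flows : Submodule ℚ (A → ℚ) where
  carrier := {x | ∀ g : V → ℚ, ∑ a, x a * (g (D.tgt a) - g (D.src a)) = 0}
  zero_mem' g := by simp
  add_mem' hx hy g := by simp only [Pi.add_apply, add_mul, Finset.sum_add_distrib, hx g, hy g,
    add_zero]
  smul_mem' c _ hx g := by
    simp only [Pi.smul_apply, smul_eq_mul, mul_assoc, ← Finset.mul_sum, hx g, mul_zero]

/-- The flows that vanish outside `B`. -/
noncomputable def flowsOn (B : Finset A) : Submodule ℚ (A → ℚ) :=
  zeros D.flows LinearMap.proj (Finset.univ \ B)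

variable {D}

theorem mem_flowsOn {B : Finset A} {x : A → ℚ} :
    x ∈ D.flowsOn B ↔ x ∈ D.flows ∧ ∀ a ∉ B, x a = 0 := by
  simp [flowsOn, mem_zeros]

theorem flowsOn_mono {B B' : Finset A} (h : B ⊆ B') : D.flowsOn B ≤ D.flowsOn B' := fun _ hx =>
  mem_flowsOn.2 ⟨(mem_flowsOn.1 hx).1, fun a ha => (mem_flowsOn.1 hx).2 a fun h' => ha (h h')⟩

variable (D) in
/-- `B` is the support of a nonnegative flow. -/
def IsFlowSupport (B : Finset A) : Prop :=
  ∃ x ∈ D.flowsOn B, ∀ a ∈ B, 0 < x a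

theorem isFlowSupport_empty : D.IsFlowSupport ∅ := ⟨0, Submodule.zero_mem _, by simp⟩

theorem IsFlowSupport.exists_nonneg {B : Finset A} (h : D.IsFlowSupport B) :
    ∃ x ∈ D.flowsOn B, (∀ a ∈ B, 0 < x a) ∧ ∀ a, 0 ≤ x a := by
  obtain ⟨x, hx, hB⟩ := h
  refine ⟨x, hx, hB, fun a => ?_⟩
  by_cases ha : a ∈ B
  · exact (hB a ha).le
  · exact ((mem_flowsOn.1 hx).2 a ha).ge

theorem IsFlowSupport.union {B B' : Finset A} (h : D.IsFlowSupport B) (h' : D.IsFlowSupport B') :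
    D.IsFlowSupport (B ∪ B') := by
  obtain ⟨x, hx, hxB, hx0⟩ := h.exists_nonneg
  obtain ⟨y, hy, hyB, hy0⟩ := h'.exists_nonneg
  refine ⟨x + y, Submodule.add_mem _ (flowsOn_mono Finset.subset_union_left hx)
    (flowsOn_mono Finset.subset_union_right hy), fun a ha => ?_⟩
  rcases Finset.mem_union.1 ha with ha | ha
  · exact add_pos_of_pos_of_nonneg (hxB a ha) (hy0 a)
  · exact add_pos_of_nonneg_of_pos (hx0 a) (hyB a ha)

theorem isFlowSupport_of_nonneg {x : A → ℚ} (hx : x ∈ D.flows) (h : ∀ a, 0 ≤ x a) :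
    D.IsFlowSupport (Finset.univ.filter fun a => x a ≠ 0) :=
  ⟨x, mem_flowsOn.2 ⟨hx, fun a ha => by simpa using ha⟩,
    fun a ha => lt_of_le_of_ne (h a) (Ne.symm (by simpa using ha))⟩

theorem IsDirectedCycle.isFlowSupport {C : Finset A} (h : D.IsDirectedCycle C) :
    D.IsFlowSupport C := by
  obtain ⟨n, c, hinj, hc, hC⟩ := h
  refine ⟨fun a => if a ∈ C then 1 else 0, mem_flowsOn.2 ⟨fun g => ?_, fun a ha => by simp [ha]⟩,
    fun a ha => by simp [ha]⟩
  have hCi : C = Finset.univ.image c := by ext a; simp [hC]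
  have hcinj : Function.Injective c := fun i j hij => hinj (congrArg D.src hij)
  simp only [ite_mul, one_mul, zero_mul, Finset.sum_ite_mem, Finset.univ_inter]
  rw [hCi, Finset.sum_image hcinj.injOn, Finset.sum_sub_distrib, sub_eq_zero]
  simp only [hc]
  -- Heads are tails shifted cyclically by one.
  exact Equiv.sum_comp (Equiv.addRight (1 : Fin (n + 1))) fun i => g (D.src (c i))

theorem IsUnionOfCycles.isFlowSupport {C : Finset A} (h : D.IsUnionOfCycles C) :
    D.IsFlowSupport C := by
  obtain ⟨S, hS, hC⟩ := h
  have hCS : C = S.sup id := by ext a; simp [hC, Finset.mem_sup]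
  rw [hCS]
  clear hC hCS
  induction S using Finset.induction_on with
  | empty => exact isFlowSupport_empty
  | insert Z S _ ih =>
    rw [Finset.sup_insert]
    exact (hS Z (Finset.mem_insert_self Z S)).isFlowSupport.union
      (ih fun Y hY => hS Y (Finset.mem_insert_of_mem hY))

/-- Test the flow against the indicator of the set reachable from the head of `a`. No arc of `B`
leaves this set, so no arc carrying positive flow can enter it. -/
theorem IsFlowSupport.reaches_src {B : Finset A} (h : D.IsFlowSupport B) {a : A} (ha : a ∈ B) :
    Relation.ReflTransGen (D.restrict B).Adj (D.tgt a) (D.src a) := by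
  obtain ⟨x, hx, hxB⟩ := h
  rw [mem_flowsOn] at hx
  let g : V → ℚ := fun v =>
    if Relation.ReflTransGen (D.restrict B).Adj (D.tgt a) v then 1 else 0
  have hg := hx.1 g
  have hnn : ∀ b ∈ Finset.univ, 0 ≤ x b * (g (D.tgt b) - g (D.src b)) := by
    intro b _
    by_cases hb : b ∈ B
    · refine mul_nonneg (hxB b hb).le (sub_nonneg.2 ?_)
      by_cases hs : Relation.ReflTransGen (D.restrict B).Adj (D.tgt a) (D.src b)
      · have ht : Relation.ReflTransGen (D.restrict B).Adj (D.tgt a) (D.tgt b) :=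
          hs.tail ⟨⟨b, hb⟩, rfl, rfl⟩
        simp [g, hs, ht]
      · simp only [g, if_neg hs]
        split_ifs <;> simp
    · simp [hx.2 b hb]
  have h0 := (Finset.sum_eq_zero_iff_of_nonneg hnn).1 hg a (Finset.mem_univ a)
  have h1 := (mul_eq_zero.1 h0).resolve_left (hxB a ha).ne'
  by_contra hs
  simp [g, hs, Relation.ReflTransGen.refl] at h1

theorem IsFlowSupport.isTotallyCyclic {B : Finset A} (h : D.IsFlowSupport B) :
    (D.restrict B).IsTotallyCyclic := by
  intro v w hvw
  have key : ∀ v w, Relation.EqvGen (D.restrict B).Adj v w →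
      Relation.ReflTransGen (D.restrict B).Adj v w ∧
        Relation.ReflTransGen (D.restrict B).Adj w v := by
    intro v w hvw
    induction hvw with
    | rel v w hvw =>
      refine ⟨.single hvw, ?_⟩
      obtain ⟨⟨a, ha⟩, rfl, rfl⟩ := hvw
      exact h.reaches_src ha
    | refl v => exact ⟨.refl, .refl⟩
    | symm v w _ ih => exact ih.symm
    | trans u v w _ _ ih ih' => exact ⟨ih.1.trans ih'.1, ih'.2.trans ih.2⟩
  exact (key v w (Quot.eqvGen_exact hvw)).1

theorem exists_walk_of_reflTransGen {r : V → V → Prop} {v w : V}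
    (h : Relation.ReflTransGen r v w) :
    ∃ (n : ℕ) (p : ℕ → V), p 0 = v ∧ p n = w ∧ ∀ i < n, r (p i) (p (i + 1)) := by
  induction h with
  | refl => exact ⟨0, fun _ => v, rfl, rfl, by simp⟩
  | @tail u w _ huw ih =>
    obtain ⟨n, p, h0, hn, hp⟩ := ih
    refine ⟨n + 1, fun i => if i ≤ n then p i else w, by simp [h0], by simp, fun i hi => ?_⟩
    rcases Nat.lt_succ_iff_lt_or_eq.1 hi with hi | rfl
    · simpa [hi.le, Nat.succ_le_of_lt hi] using hp i hi
    · simpa [hn] using huw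

theorem exists_path_of_reflTransGen {r : V → V → Prop} {v w : V}
    (h : Relation.ReflTransGen r v w) :
    ∃ (n : ℕ) (p : ℕ → V), p 0 = v ∧ p n = w ∧ (∀ i < n, r (p i) (p (i + 1))) ∧
      Set.InjOn p (Set.Iic n) := by
  have hex := exists_walk_of_reflTransGen h
  obtain ⟨p, h0, hn, hp⟩ := Nat.find_spec hex
  refine ⟨_, p, h0, hn, hp, ?_⟩
  have key : ∀ i j, i < j → j ≤ Nat.find hex → p i ≠ p j := by
    intro i j hij hj heq
    -- A repeated vertex on a shortest walk would allow the part between the two visits to be cut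
    -- out.
    refine Nat.find_min hex (m := Nat.find hex - (j - i)) (by omega)
      ⟨fun k => if k ≤ i then p k else p (k + (j - i)), by simp [h0], ?_, fun k hk => ?_⟩
    · dsimp only
      split_ifs with hle
      · have h1 : Nat.find hex - (j - i) = i := by omega
        have h2 : j = Nat.find hex := by omega
        rw [h1, heq, h2, hn]
      · rw [Nat.sub_add_cancel (by omega), hn]
    · dsimp only
      rcases lt_trichotomy k i with h1 | rfl | h1
      · rw [if_pos h1.le, if_pos (by omega)]
        exact hp k (by omega)
      · rw [if_pos le_rfl, if_neg (by omega), heq]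
        have := hp j (by omega)
        rwa [show k + 1 + (j - k) = j + 1 by omega]
      · rw [if_neg (by omega), if_neg (by omega)]
        have := hp (k + (j - i)) (by omega)
        rwa [show k + 1 + (j - i) = k + (j - i) + 1 by omega]
  intro i hi j hj hpij
  rcases lt_trichotomy i j with h1 | h1 | h1
  · exact absurd hpij (key i j h1 hj)
  · exact h1
  · exact absurd hpij.symm (key j i h1 hi)

theorem exists_directedCycle_through {V A : Type*} {D : MultiDigraph V A}
    {B : Finset A} {a : A} (ha : a ∈ B)
    (h : Relation.ReflTransGen (D.restrict B).Adj (D.tgt a) (D.src a)) :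
    ∃ Z ⊆ B, D.IsDirectedCycle Z ∧ a ∈ Z := by
  obtain ⟨n, p, h0, hn, hp, hinj⟩ := exists_path_of_reflTransGen h
  choose c hsrc htgt using hp
  -- The `n` path arcs followed by `a`, which closes the cycle; `n = 0` is the case of a loop.
  let d : Fin (n + 1) → A := fun i => if hi : i.1 < n then (c i.1 hi).1 else a
  have hdB : ∀ i, d i ∈ B := fun i => by
    simp only [d]; split_ifs with hi
    · exact (c i.1 hi).2
    · exact ha
  have hdlast : d (Fin.last n) = a := by simp [d]
  have hds : ∀ i, D.src (d i) = p i.1 := fun i => by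
    simp only [d]; split_ifs with hi
    · exact hsrc i.1 hi
    · rw [show i.1 = n by omega, hn]
  refine ⟨Finset.univ.image d, fun b hb => ?_, ⟨n, d, fun i j hij => ?_, fun i => ?_, by simp⟩, ?_⟩
  · obtain ⟨i, -, rfl⟩ := Finset.mem_image.1 hb
    exact hdB i
  · simp only [hds] at hij
    exact Fin.ext (hinj (Nat.lt_succ_iff.1 i.2) (Nat.lt_succ_iff.1 j.2) hij)
  · rw [hds]
    by_cases hi : i.1 < n
    · rw [Fin.val_add_one_of_lt (by simpa [Fin.lt_def] using hi)]
      simp only [d, dif_pos hi]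
      exact htgt i.1 hi
    · have : i = Fin.last n := Fin.ext (by simp; omega)
      rw [this, hdlast, Fin.last_add_one, Fin.val_zero, h0]
  · exact Finset.mem_image.2 ⟨Fin.last n, Finset.mem_univ _, hdlast⟩

theorem isUnionOfCycles_of_isTotallyCyclic {V A : Type*} {D : MultiDigraph V A} {B : Finset A}
    (h : (D.restrict B).IsTotallyCyclic) : D.IsUnionOfCycles B := by
  refine ⟨B.powerset.filter fun Z => D.IsDirectedCycle Z, fun Z hZ => (Finset.mem_filter.1 hZ).2,
    fun a => ⟨fun ha => ?_, ?_⟩⟩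
  · have hadj : (D.restrict B).Adj (D.src a) (D.tgt a) := ⟨⟨a, ha⟩, rfl, rfl⟩
    obtain ⟨Z, hZ, hcyc, haZ⟩ := exists_directedCycle_through ha (h _ _ (Quot.sound hadj).symm)
    exact ⟨Z, Finset.mem_filter.2 ⟨Finset.mem_powerset.2 hZ, hcyc⟩, haZ⟩
  · rintro ⟨Z, hZ, haZ⟩
    exact Finset.mem_powerset.1 (Finset.mem_filter.1 hZ).1 haZ

theorem isTotallyCyclic_iff {B : Finset A} :
    (D.restrict B).IsTotallyCyclic ↔ D.IsFlowSupport B :=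
  ⟨fun h => (isUnionOfCycles_of_isTotallyCyclic h).isFlowSupport, fun h => h.isTotallyCyclic⟩

theorem isUnionOfCycles_iff {B : Finset A} : D.IsUnionOfCycles B ↔ D.IsFlowSupport B :=
  ⟨fun h => h.isFlowSupport, fun h => isUnionOfCycles_of_isTotallyCyclic h.isTotallyCyclic⟩

/-- The Euler relation for the supports of nonnegative flows inside `M`. -/
theorem sum_isFlowSupport (M : Finset A) :
    ∑ B ∈ M.powerset,
      (if D.IsFlowSupport B then (-1 : ℤ) ^ Module.finrank ℚ (D.flowsOn B) else 0)
      = if ∀ B ⊆ M, D.IsFlowSupport B → B = ∅ then 1 else 0 := by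
  have hz : ∀ B ⊆ M, zeros (D.flowsOn M) LinearMap.proj (M \ B) = D.flowsOn B := by
    intro B hB
    ext x
    simp only [mem_zeros, mem_flowsOn, LinearMap.proj_apply, Finset.mem_sdiff, and_assoc]
    refine and_congr_right fun _ => ⟨fun h a ha => ?_, fun h => ⟨fun a ha => h a fun h' => ha (hB h'),
      fun a ha => h a ha.2⟩⟩
    by_cases haM : a ∈ M
    · exact h.2 a ⟨haM, ha⟩
    · exact h.1 a haM
  have hface : ∀ B ∈ M.powerset, faceTerm (D.flowsOn M) LinearMap.proj M B =
      if D.IsFlowSupport B then (-1 : ℤ) ^ Module.finrank ℚ (D.flowsOn B) else 0 := by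
    intro B hB
    unfold faceTerm
    rw [hz B (Finset.mem_powerset.1 hB)]
    rfl
  have hlin : IsLinear (D.flowsOn M) LinearMap.proj M ↔
      ∀ B ⊆ M, D.IsFlowSupport B → B = ∅ := by
    constructor
    · intro h B hB hBs
      obtain ⟨x, hx, hxB, hx0⟩ := hBs.exists_nonneg
      by_contra hne
      obtain ⟨a, ha⟩ := Finset.nonempty_iff_ne_empty.2 hne
      exact (hxB a ha).ne' (h x (flowsOn_mono hB hx) (fun b _ => hx0 b) a (hB ha))
    · intro h x hx hx0 a _
      have hxM := mem_flowsOn.1 hx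
      have hnn : ∀ a, 0 ≤ x a := fun a => by
        by_cases ha : a ∈ M
        · exact hx0 a ha
        · exact (hxM.2 a ha).ge
      have := h _ (fun b hb => by
        by_contra hbM
        exact (Finset.mem_filter.1 hb).2 (hxM.2 b hbM)) (isFlowSupport_of_nonneg hxM.1 hnn)
      by_contra hne
      exact Finset.notMem_empty a (this ▸ Finset.mem_filter.2 ⟨Finset.mem_univ a, hne⟩)
  -- The cone is pointed, hence the value 1 in the linear case.
  have hbot : zeros (D.flowsOn M) LinearMap.proj M = ⊥ := by
    rw [eq_bot_iff]
    intro x hx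
    refine (Submodule.mem_bot ℚ).2 (funext fun a => ?_)
    by_cases ha : a ∈ M
    · exact hx.2 a ha
    · exact (mem_flowsOn.1 hx.1).2 a ha
  rw [← Finset.sum_congr rfl hface, sum_faceTerm, linearTerm, hbot, finrank_bot, pow_zero]
  simp only [hlin]

end

end MultiDigraph

/-! ### Gradedness of `Q` by the dimension of the flow space -/

section
variable {α : Type*} [PartialOrder α] {r : α → ℕ}

theorem Order.height_eq_of_strictMono_of_gap [Finite α] (hr : StrictMono r)
    (hgap : ∀ a b, a < b → r a + 2 ≤ r b → ∃ c, a < c ∧ c < b)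
    (hbot : ∀ b, 0 < r b → ∃ a, a < b) (b : α) : Order.height b = r b := by
  refine le_antisymm ?_ ?_
  · simpa using Order.height_le_height_apply_of_strictMono r hr b
  · induction hn : r b using Nat.strong_induction_on generalizing b with
    | _ n ih =>
    rcases Nat.eq_zero_or_pos n with rfl | hpos
    · simp
    obtain ⟨a, ha⟩ := hbot b (hn ▸ hpos)
    -- Among the elements below `b`, one with `r` maximal; the gap condition forces `r c + 1 = r b`.
    obtain ⟨c, hc, hmax⟩ :=
      (Set.toFinite (Set.Iio b)).exists_maximalFor r _ ⟨a, ha⟩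
    have hcb : r c < r b := hr hc
    have h1 : r c + 1 = n := by
      by_contra hne
      obtain ⟨d, hcd, hdb⟩ := hgap c b hc (by omega)
      have h1 := hr hcd
      have h2 := hmax hdb h1.le
      omega
    have h2 := ih (r c) (by omega) c rfl
    calc (n : ℕ∞) = (r c : ℕ∞) + 1 := by rw [← h1]; simp
      _ ≤ Order.height c + 1 := by gcongr
      _ ≤ Order.height b := Order.height_add_one_le hc

theorem CovBy.eq_add_one_of_gap (hr : StrictMono r)
    (hgap : ∀ a b, a < b → r a + 2 ≤ r b → ∃ c, a < c ∧ c < b) {a b : α} (h : a ⋖ b) :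
    r b = r a + 1 := by
  have h1 := hr h.lt
  by_contra hne
  obtain ⟨c, hac, hcb⟩ := hgap a b h.lt (by omega)
  exact h.2 hac hcb

end

namespace MultiDigraph

section flows
open scoped Classical

variable {V A : Type*} [Fintype A] {D : MultiDigraph V A}

theorem flowsOn_empty : D.flowsOn ∅ = ⊥ :=
  eq_bot_iff.2 fun x hx => (Submodule.mem_bot ℚ).2 (funext fun a => (mem_flowsOn.1 hx).2 a (by simp))

theorem IsFlowSupport.finrank_lt {B B' : Finset A} (h' : D.IsFlowSupport B') (h : B ⊂ B') :
    Module.finrank ℚ (D.flowsOn B) < Module.finrank ℚ (D.flowsOn B') := by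
  refine Submodule.finrank_lt_finrank_of_lt (lt_of_le_of_ne (flowsOn_mono h.1) fun heq => ?_)
  obtain ⟨y, hy, hyB⟩ := h'
  obtain ⟨a, ha, haB⟩ := Set.not_subset.1 h.2
  exact (hyB a ha).ne' ((mem_flowsOn.1 (heq ▸ hy)).2 a haB)

/-- A flow that is nonnegative on `B' \ B`, zero at some arc there but not at all of them, yields an
intermediate support when a small multiple of it is added to a positive flow on `B`. -/
theorem IsFlowSupport.exists_between {B B' : Finset A} (h : D.IsFlowSupport B)
    (h' : D.IsFlowSupport B') (hss : B ⊂ B')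
    (hr : Module.finrank ℚ (D.flowsOn B) + 2 ≤ Module.finrank ℚ (D.flowsOn B')) :
    ∃ C, D.IsFlowSupport C ∧ B ⊂ C ∧ C ⊂ B' := by
  obtain ⟨x, hx, hxB, hx0⟩ := h.exists_nonneg
  obtain ⟨y, hy, hyB⟩ := h'
  obtain ⟨z, hz, hzU⟩ : ∃ z ∈ D.flowsOn B', z ∉ D.flowsOn B ⊔ Submodule.span ℚ {y} := by
    by_contra hcon
    push Not at hcon
    have h1 := Submodule.finrank_mono (show D.flowsOn B' ≤ _ from hcon)
    have h2 := Submodule.finrank_add_le_finrank_add_finrank (D.flowsOn B) (Submodule.span ℚ {y})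
    have h3 := finrank_span_le_card (R := ℚ) ({y} : Set (A → ℚ))
    rw [Set.toFinset_singleton, Finset.card_singleton] at h3
    omega
  -- The maximal ratio is the least `t` for which `z + t • y` is nonnegative on `B' \ B`; the value
  -- at `e` is then zero.
  obtain ⟨e, he, hmax⟩ := Finset.exists_max_image (B' \ B) (fun a => -z a / y a)
    (Finset.sdiff_nonempty.2 hss.2)
  obtain ⟨heB', heB⟩ := Finset.mem_sdiff.1 he
  let t := -z e / y e
  let w := z + t • y
  have hw : w ∈ D.flowsOn B' := Submodule.add_mem _ hz (Submodule.smul_mem _ _ hy)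
  have hwB : w ∉ D.flowsOn B := fun hc => hzU (by
    have : z = w + (-t) • y := by simp [w]
    rw [this]
    exact Submodule.add_mem_sup hc (Submodule.smul_mem _ _ (Submodule.mem_span_singleton_self y)))
  have hwe : w e = 0 := by
    have := (hyB e heB').ne'
    simp only [w, t, Pi.add_apply, Pi.smul_apply, smul_eq_mul]
    field_simp
    ring
  have hwnn : ∀ a ∈ B', a ∉ B → 0 ≤ w a := fun a ha haB => by
    have h1 := hmax a (Finset.mem_sdiff.2 ⟨ha, haB⟩)
    have h2 := (div_le_iff₀ (hyB a ha)).1 h1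
    simp only [w, t, Pi.add_apply, Pi.smul_apply, smul_eq_mul]
    linarith
  obtain ⟨ε, hε, hlt⟩ := exists_pos_forall_mul_abs_lt B x w hxB
  let u := x + ε • w
  have hu : u ∈ D.flowsOn B' :=
    Submodule.add_mem _ (flowsOn_mono hss.1 hx) (Submodule.smul_mem _ _ hw)
  have huB : ∀ a ∈ B, 0 < u a := fun a ha => by
    have h1 := hlt a ha
    have h2 := neg_abs_le (w a)
    simp only [u, Pi.add_apply, Pi.smul_apply, smul_eq_mul]
    nlinarith
  have hunB : ∀ a ∉ B, u a = ε * w a := fun a ha => by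
    simp [u, (mem_flowsOn.1 hx).2 a ha]
  have hu0 : ∀ a, 0 ≤ u a := fun a => by
    by_cases ha : a ∈ B
    · exact (huB a ha).le
    · rw [hunB a ha]
      refine mul_nonneg hε.le ?_
      by_cases ha' : a ∈ B'
      · exact hwnn a ha' ha
      · exact ((mem_flowsOn.1 hw).2 a ha').ge
  refine ⟨_, isFlowSupport_of_nonneg (mem_flowsOn.1 hu).1 hu0,
    Finset.ssubset_iff_subset_ne.2 ⟨fun a ha => by simpa using (huB a ha).ne', fun heq => hwB ?_⟩,
    Finset.ssubset_iff_subset_ne.2 ⟨fun a ha => ?_, fun heq => ?_⟩⟩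
  · refine mem_flowsOn.2 ⟨(mem_flowsOn.1 hw).1, fun a ha => ?_⟩
    have h1 : u a = 0 := by
      by_contra hne
      exact ha (heq ▸ Finset.mem_filter.2 ⟨Finset.mem_univ a, hne⟩)
    rw [hunB a ha] at h1
    exact (mul_eq_zero.1 h1).resolve_left hε.ne'
  · by_contra ha'
    exact (Finset.mem_filter.1 ha).2 ((mem_flowsOn.1 hu).2 a ha')
  · have : e ∈ Finset.univ.filter fun a => u a ≠ 0 := heq ▸ heB'
    exact (Finset.mem_filter.1 this).2 (by rw [hunB e heB, hwe, mul_zero])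

theorem strictMono_finrank_flowsOn :
    StrictMono fun B : D.Q => Module.finrank ℚ (D.flowsOn B.1) := fun _ B' h =>
  (isTotallyCyclic_iff.1 B'.2).finrank_lt h

theorem Q.exists_between (B B' : D.Q) (h : B < B')
    (hr : Module.finrank ℚ (D.flowsOn B.1) + 2 ≤ Module.finrank ℚ (D.flowsOn B'.1)) :
    ∃ C : D.Q, B < C ∧ C < B' := by
  obtain ⟨C, hC, h1, h2⟩ :=
    (isTotallyCyclic_iff.1 B.2).exists_between (isTotallyCyclic_iff.1 B'.2) h hr
  exact ⟨⟨C, isTotallyCyclic_iff.2 hC⟩, h1, h2⟩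

/-- The rank in `Q` is the dimension of the space of flows. -/
theorem rkQ_eq_finrank (B : D.Q) : D.rkQ B = Module.finrank ℚ (D.flowsOn B.1) := by
  rw [rkQ, Order.height_eq_of_strictMono_of_gap strictMono_finrank_flowsOn Q.exists_between]
  · rfl
  · intro B hB
    refine ⟨⟨∅, isTotallyCyclic_iff.2 isFlowSupport_empty⟩, ?_⟩
    refine Finset.ssubset_iff_subset_ne.2 ⟨Finset.empty_subset _, fun heq => ?_⟩
    change ∅ = B.1 at heq
    rw [← heq, flowsOn_empty, finrank_bot] at hB
    exact lt_irrefl _ hB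

theorem rkQ_eq_add_one_of_covBy {B B' : D.Q} (h : B ⋖ B') : D.rkQ B' = D.rkQ B + 1 := by
  rw [rkQ_eq_finrank, rkQ_eq_finrank]
  exact CovBy.eq_add_one_of_gap strictMono_finrank_flowsOn Q.exists_between h

end flows

/-! ### Ranks of contractions and numbers of components -/

section rank

variable {V A : Type*}

instance [Finite V] (D : MultiDigraph V A) : Finite D.Component :=
  inferInstanceAs (Finite (Quot D.Adj))

/-- Rank–nullity for the transposed incidence matrix, whose kernel consists of the functions
constant on components. -/
theorem rank_add_numComponents [Finite V] [Finite A] (D : MultiDigraph V A) :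
    D.rank + D.numComponents = Nat.card V := by
  classical
  let _ : Fintype A := Fintype.ofFinite A
  let _ : Fintype V := Fintype.ofFinite V
  let _ : Fintype D.Component := Fintype.ofFinite _
  have hker : LinearMap.ker D.incMatrix.transpose.mulVecLin =
      LinearMap.range (LinearMap.funLeft ℚ ℚ (Quot.mk D.Adj)) := by
    have hval : ∀ f a, D.incMatrix.transpose.mulVec f a = f (D.tgt a) - f (D.src a) := by
      intro f a
      simp [Matrix.mulVec, dotProduct, incMatrix, sub_mul, Finset.sum_sub_distrib]
    ext f
    rw [LinearMap.mem_ker, LinearMap.mem_range, Matrix.mulVecLin_apply]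
    constructor
    · intro h
      refine ⟨Quot.lift f ?_, rfl⟩
      rintro _ _ ⟨a, rfl, rfl⟩
      have := congrFun h a
      rw [hval] at this
      exact (sub_eq_zero.1 this).symm
    · rintro ⟨g, rfl⟩
      funext a
      rw [hval]
      have hadj : D.Adj (D.src a) (D.tgt a) := ⟨a, rfl, rfl⟩
      simp [LinearMap.funLeft_apply, Quot.sound hadj]
  have hinj : Function.Injective (LinearMap.funLeft ℚ ℚ (Quot.mk D.Adj)) :=
    LinearMap.funLeft_injective_of_surjective ℚ ℚ _ Quot.mk_surjective
  have h := D.incMatrix.transpose.mulVecLin.finrank_range_add_finrank_ker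
  have hc : Module.finrank ℚ (Quot D.Adj → ℚ) = D.numComponents := by
    have : Fintype (Quot D.Adj) := Fintype.ofFinite _
    rw [Module.finrank_fintype_fun_eq_card, ← Nat.card_eq_fintype_card]
    rfl
  rw [hker, LinearMap.finrank_range_of_inj hinj, hc, Module.finrank_fintype_fun_eq_card,
    ← Nat.card_eq_fintype_card] at h
  rw [← h]
  congr 1
  exact (Matrix.rank_transpose D.incMatrix).symm

theorem numComponents_contract (D : MultiDigraph V A) (C : Finset A) :
    (D.contract C).numComponents = D.numComponents := by
  classical
  refine Nat.card_congr ⟨Quot.lift (Quot.lift (Quot.mk D.Adj) ?_) ?_,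
    Quot.lift (fun v => Quot.mk _ (Quot.mk _ v)) ?_, ?_, ?_⟩
  · rintro _ _ ⟨a, rfl, rfl⟩
    exact Quot.sound ⟨a.1, rfl, rfl⟩
  · rintro _ _ ⟨a, rfl, rfl⟩
    exact Quot.sound ⟨a.1, rfl, rfl⟩
  · rintro _ _ ⟨a, rfl, rfl⟩
    by_cases ha : a ∈ C
    · exact congrArg (Quot.mk _) (Quot.sound ⟨⟨a, ha⟩, rfl, rfl⟩)
    · exact Quot.sound ⟨⟨a, ha⟩, rfl, rfl⟩
  · rintro ⟨⟨v⟩⟩; rfl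
  · rintro ⟨v⟩; rfl

theorem rank_contract_add [Finite V] [Finite A] (D : MultiDigraph V A) (C : Finset A) :
    (D.contract C).rank + D.numComponents = (D.restrict C).numComponents := by
  rw [← numComponents_contract D C, rank_add_numComponents]
  rfl

end rank

end MultiDigraph

/-! ### The Möbius function of the poset of contractions -/

theorem IncidenceAlgebra.mu_eq_of_sum_Icc_eq_zero {α : Type*} [PartialOrder α]
    [LocallyFiniteOrder α] [DecidableEq α] {f : α → ℤ} {a : α} (ha : f a = 1)
    (hf : ∀ b, a < b → ∑ x ∈ Finset.Icc a b, f x = 0) {b : α} (hab : a ≤ b) :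
    IncidenceAlgebra.mu ℤ a b = f b := by
  induction hn : (Finset.Icc a b).card using Nat.strong_induction_on generalizing b with
  | _ n ih =>
  subst hn
  rw [IncidenceAlgebra.mu_apply]
  split_ifs with h
  · rw [← h, ha]
  · have hlt := lt_of_le_of_ne hab h
    have hs : ∑ x ∈ Finset.Ico a b, IncidenceAlgebra.mu ℤ a x = ∑ x ∈ Finset.Ico a b, f x := by
      refine Finset.sum_congr rfl fun x hx => ih _ ?_ (Finset.mem_Ico.1 hx).1 rfl
      refine Finset.card_lt_card (Finset.ssubset_iff_subset_ne.2
        ⟨Finset.Icc_subset_Icc_right (Finset.mem_Ico.1 hx).2.le, fun heq => ?_⟩)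
      have : b ∈ Finset.Icc a x := heq ▸ Finset.right_mem_Icc.2 hab
      exact (Finset.mem_Ico.1 hx).2.not_ge (Finset.mem_Icc.1 this).2
    have h0 := hf b hlt
    rw [← Finset.Ico_insert_right hab, Finset.sum_insert Finset.right_notMem_Ico] at h0
    rw [hs]
    linarith

namespace MultiDigraph

open scoped Classical

section mobius
variable {V A : Type*} [Fintype A] {D : MultiDigraph V A}

theorem mobius_uncontracted (Y : D.CyclePoset) :
    D.mobius (CyclePoset.uncontracted D) Y = (-1) ^ Module.finrank ℚ (D.flowsOn Y.1) := by
  let _ : LocallyFiniteOrder D.CyclePoset := Fintype.toLocallyFiniteOrder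
  have hmin : ∀ Y, CyclePoset.uncontracted D ≤ Y := fun Y => Finset.empty_subset Y.1
  refine IncidenceAlgebra.mu_eq_of_sum_Icc_eq_zero
    (f := fun Y : D.CyclePoset => (-1 : ℤ) ^ Module.finrank ℚ (D.flowsOn Y.1)) ?_
    (fun Y hY => ?_) (hmin Y)
  · change (-1 : ℤ) ^ Module.finrank ℚ (D.flowsOn ∅) = 1
    rw [flowsOn_empty, finrank_bot, pow_zero]
  · have h := sum_isFlowSupport (D := D) Y.1
    rw [if_neg, ← Finset.sum_filter] at h
    · rw [← h]
      refine Finset.sum_nbij Subtype.val (fun X hX => ?_) Subtype.val_injective.injOn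
        (fun B hB => ?_) fun _ _ => rfl
      · exact Finset.mem_filter.2 ⟨Finset.mem_powerset.2 (Finset.mem_Icc.1 hX).2,
          isUnionOfCycles_iff.1 X.2⟩
      · obtain ⟨h1, h2⟩ := Finset.mem_filter.1 hB
        exact ⟨⟨B, isUnionOfCycles_iff.2 h2⟩,
          Finset.mem_coe.2 (Finset.mem_Icc.2 ⟨hmin _, Finset.mem_powerset.1 h1⟩), rfl⟩
    · intro hcon
      exact hY.ne (Subtype.ext (hcon Y.1 subset_rfl (isUnionOfCycles_iff.1 Y.2)).symm)

end mobius

/-! ### Counting acyclic colorings -/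

section coloring
variable {V A : Type*} [Fintype A] {D : MultiDigraph V A}

/-- The arcs whose end vertices have the same color. -/
noncomputable def monoArcs {K : Type*} (D : MultiDigraph V A) (f : V → K) : Finset A :=
  Finset.univ.filter fun a => f (D.src a) = f (D.tgt a)

theorem subset_monoArcs {K : Type*} {f : V → K} {B : Finset A} :
    B ⊆ D.monoArcs f ↔ ∀ a ∈ B, f (D.src a) = f (D.tgt a) := by
  simp [Finset.subset_iff, monoArcs]

theorem IsDirectedCycle.monochromatic {K : Type*} {f : V → K} {Z : Finset A}
    (hZ : D.IsDirectedCycle Z) (h : Z ⊆ D.monoArcs f) :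
    ∃ κ : K, ∀ a ∈ Z, f (D.src a) = κ ∧ f (D.tgt a) = κ := by
  obtain ⟨n, c, -, hc, hZc⟩ := hZ
  rw [subset_monoArcs] at h
  have hcZ : ∀ i, f (D.src (c i)) = f (D.tgt (c i)) := fun i => h _ ((hZc _).2 ⟨i, rfl⟩)
  have key : ∀ i, f (D.src (c i)) = f (D.src (c 0)) := by
    intro i
    induction i using Fin.induction with
    | zero => rfl
    | succ i ih => rw [← ih, hcZ i.castSucc, hc, Fin.coeSucc_eq_succ]
  refine ⟨f (D.src (c 0)), fun a ha => ?_⟩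
  obtain ⟨i, rfl⟩ := (hZc a).1 ha
  exact ⟨key i, (hcZ i).symm.trans (key i)⟩

theorem IsDirectedCycle.nonempty {V A : Type*} {D : MultiDigraph V A} {Z : Finset A}
    (hZ : D.IsDirectedCycle Z) : Z.Nonempty := by
  obtain ⟨n, c, -, -, hZc⟩ := hZ
  exact ⟨c 0, (hZc _).2 ⟨0, rfl⟩⟩

theorem isAcyclicColoring_iff {K : Type*} {f : V → K} :
    D.IsAcyclicColoring f ↔ ∀ B ⊆ D.monoArcs f, D.IsFlowSupport B → B = ∅ := by
  constructor
  · intro h B hB hBs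
    by_contra hne
    obtain ⟨a, ha⟩ := Finset.nonempty_iff_ne_empty.2 hne
    obtain ⟨Z, hZB, hZ, -⟩ := exists_directedCycle_through ha (hBs.reaches_src ha)
    exact h Z hZ (hZ.monochromatic (hZB.trans hB))
  · rintro h C hC ⟨κ, hκ⟩
    refine hC.nonempty.ne_empty (h C (subset_monoArcs.2 fun a ha => ?_) hC.isFlowSupport)
    rw [(hκ a ha).1, (hκ a ha).2]

theorem card_colorings_subset_monoArcs [Finite V] (B : Finset A) (k : ℕ) :
    Nat.card {f : V → Fin k // B ⊆ D.monoArcs f} = k ^ (D.restrict B).numComponents := by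
  have e : {f : V → Fin k // B ⊆ D.monoArcs f} ≃ ((D.restrict B).Component → Fin k) :=
    { toFun := fun f => Quot.lift f.1 (by
        rintro _ _ ⟨a, rfl, rfl⟩
        exact subset_monoArcs.1 f.2 a.1 a.2)
      invFun := fun g => ⟨fun v => g (Quot.mk _ v), subset_monoArcs.2 fun a ha =>
        congrArg g (Quot.sound ⟨⟨a, ha⟩, rfl, rfl⟩)⟩
      left_inv := fun f => rfl
      right_inv := fun g => by funext v; induction v using Quot.ind; rfl }
  rw [Nat.card_congr e, Nat.card_fun, Nat.card_fin, numComponents]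

theorem sum_Q {M : Type*} [AddCommMonoid M] (g : Finset A → M) :
    ∑ B : D.Q, g B.1 = ∑ B : Finset A, if D.IsFlowSupport B then g B else 0 := by
  rw [← Finset.sum_filter]
  exact (Finset.sum_subtype _ (by simp [isTotallyCyclic_iff]) g).symm

theorem sum_cyclePoset {M : Type*} [AddCommMonoid M] (g : Finset A → M) :
    ∑ C : D.CyclePoset, g C.1 = ∑ B : Finset A, if D.IsFlowSupport B then g B else 0 := by
  rw [← Finset.sum_filter]
  exact (Finset.sum_subtype _ (by simp [isUnionOfCycles_iff]) g).symm

theorem card_isAcyclicColoring [Finite V] (k : ℕ) :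
    (Nat.card {f : V → Fin k // D.IsAcyclicColoring f} : ℤ) =
      ∑ B : D.Q, (-1) ^ D.rkQ B * (k : ℤ) ^ (D.restrict B.1).numComponents := by
  let _ : Fintype V := Fintype.ofFinite V
  simp only [rkQ_eq_finrank]
  rw [sum_Q fun B => (-1) ^ Module.finrank ℚ (D.flowsOn B) *
    (k : ℤ) ^ (D.restrict B).numComponents]
  have hcount : ∀ p : (V → Fin k) → Prop,
      (Nat.card {f // p f} : ℤ) = ∑ f, if p f then 1 else 0 := fun p => by
    rw [Nat.card_eq_fintype_card, Fintype.card_subtype, Finset.sum_boole]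
  rw [hcount]
  -- The Euler relation on `monoArcs f` replaces the indicator of acyclicity by a signed sum over
  -- supports.
  simp only [isAcyclicColoring_iff, ← sum_isFlowSupport]
  have hext : ∀ M : Finset A, ∑ B ∈ M.powerset,
      (if D.IsFlowSupport B then (-1 : ℤ) ^ Module.finrank ℚ (D.flowsOn B) else 0) =
      ∑ B : Finset A, if B ⊆ M then
        (if D.IsFlowSupport B then (-1 : ℤ) ^ Module.finrank ℚ (D.flowsOn B) else 0) else 0 := by
    intro M
    have hM : M.powerset = Finset.univ.filter (· ⊆ M) := by ext B; simp
    rw [hM, Finset.sum_filter]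
  simp only [hext]
  rw [Finset.sum_comm]
  refine Finset.sum_congr rfl fun B _ => ?_
  have hB := card_colorings_subset_monoArcs (D := D) B k
  have hB' := hcount fun f => B ⊆ D.monoArcs f
  rw [hB] at hB'
  push_cast at hB'
  split_ifs
  · rw [hB', Finset.mul_sum]
    refine Finset.sum_congr rfl fun f _ => ?_
    simp
  · simp

end coloring

/-! ### The chromatic polynomial -/

section chromatic
variable {V A : Type*} [Finite A] (D : MultiDigraph V A)

theorem isChromaticPolynomial_sum_Q [Finite V] : D.IsChromaticPolynomial
    (∑ B : D.Q, (-1) ^ D.rkQ B * X ^ ((D.contract B.1).rank + D.numComponents)) := by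
  let _ : Fintype A := Fintype.ofFinite A
  intro k
  rw [card_isAcyclicColoring, eval_finsetSum]
  refine Finset.sum_congr rfl fun B _ => ?_
  simp [rank_contract_add]

theorem X_pow_mul_nlCoflowPoly : X ^ D.numComponents * D.nlCoflowPoly =
    ∑ B : D.Q, (-1) ^ D.rkQ B * X ^ ((D.contract B.1).rank + D.numComponents) := by
  let _ : Fintype A := Fintype.ofFinite A
  simp only [nlCoflowPoly, mobius_uncontracted, rkQ_eq_finrank]
  rw [sum_Q fun B => (-1 : ℤ[X]) ^ Module.finrank ℚ (D.flowsOn B) *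
      X ^ ((D.contract B).rank + D.numComponents),
    sum_cyclePoset fun B => C ((-1 : ℤ) ^ Module.finrank ℚ (D.flowsOn B)) *
      X ^ (D.contract B).rank, Finset.mul_sum]
  refine Finset.sum_congr rfl fun B _ => ?_
  split_ifs
  · simp only [map_pow, map_neg, map_one, pow_add]
    ring
  · simp

theorem IsChromaticPolynomial.unique {V A : Type*} {D : MultiDigraph V A} {p q : ℤ[X]}
    (hp : D.IsChromaticPolynomial p)
    (hq : D.IsChromaticPolynomial q) : p = q := by
  refine Polynomial.eq_of_infinite_eval_eq p q
    ((Set.infinite_range_of_injective (Nat.cast_injective (R := ℤ))).mono ?_)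
  rintro _ ⟨k, rfl⟩
  exact (hp k).trans (hq k).symm

end chromatic

end MultiDigraph

theorem mainTheorem5 {V A : Type*} [Finite V] [Finite A] (D : MultiDigraph V A) :
    (∀ B B' : D.Q, B ⋖ B' → D.rkQ B' = D.rkQ B + 1) ∧
    (∃! χ : ℤ[X], D.IsChromaticPolynomial χ) ∧
    ∀ χ : ℤ[X], D.IsChromaticPolynomial χ →
      χ = X ^ D.numComponents * D.nlCoflowPoly ∧
      χ = ∑ B : D.Q, (-1) ^ D.rkQ B * X ^ ((D.contract B.1).rank + D.numComponents) := by
  let _ : Fintype A := Fintype.ofFinite A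
  have hQ := D.isChromaticPolynomial_sum_Q
  refine ⟨fun B B' h => MultiDigraph.rkQ_eq_add_one_of_covBy h,
    ⟨_, hQ, fun p hp => hp.unique hQ⟩, fun χ hχ => ⟨?_, hχ.unique hQ⟩⟩
  rw [D.X_pow_mul_nlCoflowPoly]
  exact hχ.unique hQ
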